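/- Let $a<b$ be real numbers and let $\mu$ be the uniform probability distribution on $[a,b]$. Let $H^1(a,b)$ be the space of (continuous representatives of) functions $f\in L^2(\mu)$ whose weak derivative $f'$ belongs to $L^2(\mu)$, with the norm $\|f\|_{H^1}^2=\int f^2\,d\mu+\int (f')^2\,d\mu$. For nodes $X=(x_1,\dots,x_n)\in[a,b]^n$ and weights $w\in\mathbb R^n$, the worst-case error in $H^1(a,b)$ is $$\mathrm{wce}(X,w)=\sup_{f\in H^1(a,b),\ \|f\|_{H^1}\le 1}\left|\int f\,d\mu-\sum_{i=1}^n w_i f(x_i)\right|.$$ A Poincaré basis is a Hilbert basis $(\varphi_m)_{m\ge 0}$ of $L^2(\mu)$, with $\varphi_0=1$, formed by functions $\varphi_m\in H^1(a,b)$ such that $\int\varphi_m' g'\,d\mu=\lambda_m\int\varphi_m g\,d\mu$ for all $g\in H^1(a,b)$, with $\lambda_0<\lambda_1<\cdots$. For $n\ge 1$, the $n$-node Poincaré quadrature $(X_P,w_P)$ is the quadrature with $n$ distinct nodes in $[a,b]$ (listed increasingly) and positive weights which is exact for $\varphi_0,\dots,\varphi_{2n-1}$, that is $\int\varphi_m\,d\mu=\sum_{i=1}^n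 w_i\varphi_m(x_i)$ for $0\le m\le 2n-1$. Then, for every $n\ge1$, the $n$-node Poincaré quadrature exists and is unique (it does not depend on the choice of the Poincaré basis), and its worst-case error $\mathrm{wce}(n)=\mathrm{wce}(X_P,w_P)$ is $$\mathrm{wce}(n)=\left(\frac{h}{\tanh h}-1\right)^{1/2},\qquad h=\frac{b-a}{2n}.$$ Moreover, as $n\to\infty$, $$\mathrm{wce}(n)\sim\frac{b-a}{2\sqrt3}\,\frac1n .$$ -/

import Mathlib

namespace PoincareQuadrature

open MeasureTheory
open scoped ContDiff ENNReal

/-- The uniform probability distribution on `[a, b]`. -/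
noncomputable def uniform (a b : ℝ) : Measure ℝ :=
  ProbabilityTheory.cond volume (Set.Icc a b)

/-- `g` is a weak derivative of `f` on the open interval `(a, b)`. -/
structure HasWeakDerivOn (a b : ℝ) (f g : ℝ → ℝ) : Prop where
  locallyIntegrable : LocallyIntegrableOn f (Set.Ioo a b)
  locallyIntegrable_deriv : LocallyIntegrableOn g (Set.Ioo a b)
  integral_eq : ∀ ψ : ℝ → ℝ, ContDiff ℝ ∞ ψ → HasCompactSupport ψ →
    tsupport ψ ⊆ Set.Ioo a b →
    ∫ x in Set.Ioo a b, f x * deriv ψ x = -∫ x in Set.Ioo a b, g x * ψ x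

/-- `f` is (the continuous representative of) an element of the Sobolev space `H¹(μ)`, for a
measure `μ` on `[a, b]`, and `f'` is its weak derivative. Only the values of `f` on `[a, b]`
matter; the continuous representative is taken because functions are evaluated at points. -/
structure MemH1 (μ : Measure ℝ) (a b : ℝ) (f f' : ℝ → ℝ) : Prop where
  continuousOn : ContinuousOn f (Set.Icc a b)
  memLp : MemLp f 2 μ
  memLp_deriv : MemLp f' 2 μ
  hasWeakDerivOn : HasWeakDerivOn a b f f'

/-- The usual norm of `H¹(μ)`, for a function `f` with weak derivative `f'`. -/
noncomputable def h1Norm (μ : Measure ℝ) (f f' : ℝ → ℝ) : ℝ :=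
  Real.sqrt ((∫ x, f x ^ 2 ∂μ) + ∫ x, f' x ^ 2 ∂μ)

/-- The worst-case error over the unit ball of `H¹(μ)` of the quadrature with nodes `X` and
weights `w`. -/
noncomputable def wce (μ : Measure ℝ) (a b : ℝ) {n : ℕ} (X w : Fin n → ℝ) : ℝ≥0∞ :=
  ⨆ (f : ℝ → ℝ) (f' : ℝ → ℝ) (_ : MemH1 μ a b f f') (_ : h1Norm μ f f' ≤ 1),
    ENNReal.ofReal |(∫ x, f x ∂μ) - ∑ i, w i * f (X i)|

/-- `f ∈ H¹(μ)` solves the weak spectral problem `⟨f', g'⟩ = lam ⟨f, g⟩` for all `g ∈ H¹(μ)`. -/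
def SolvesSpectral (μ : Measure ℝ) (a b lam : ℝ) (f : ℝ → ℝ) : Prop :=
  ∃ f' : ℝ → ℝ, MemH1 μ a b f f' ∧
    ∀ g g' : ℝ → ℝ, MemH1 μ a b g g' →
      ∫ x, f' x * g' x ∂μ = lam * ∫ x, f x * g x ∂μ

/-- `φ` is a Poincaré basis of `L²(μ)`: a Hilbert basis of `L²(μ)` formed by the eigenfunctions
of the spectral problem, ordered by increasing eigenvalues, with `φ 0 = 1`. -/
structure IsPoincareBasis (μ : Measure ℝ) (a b : ℝ) (φ : ℕ → ℝ → ℝ) : Prop where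
  eigen : ∃ lam : ℕ → ℝ, StrictMono lam ∧ ∀ m, SolvesSpectral μ a b (lam m) (φ m)
  hilbertBasis : ∃ B : HilbertBasis ℕ ℝ (Lp ℝ 2 μ), ∀ m, (B m : ℝ → ℝ) =ᵐ[μ] φ m
  zero_eq_one : ∀ x ∈ Set.Icc a b, φ 0 x = 1

/-- The quadrature with `n` distinct nodes `X` in `[a, b]`, listed in increasing order, and
positive weights `w` is a Gaussian quadrature of the system `u`: it is exact at order `2n - 1`,
that is for `u 0, …, u (2n - 1)`. -/
structure IsGaussQuadrature (μ : Measure ℝ) (a b : ℝ) (u : ℕ → ℝ → ℝ) {n : ℕ}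
    (X w : Fin n → ℝ) : Prop where
  strictMono : StrictMono X
  mem_Icc : ∀ i, X i ∈ Set.Icc a b
  weight_pos : ∀ i, 0 < w i
  exact_integral : ∀ m < 2 * n, ∫ x, u m x ∂μ = ∑ i, w i * u m (X i)

/-- The Poincaré quadrature of `H¹(μ)`: the Gaussian quadrature of the Poincaré basis. (The basis
is unique up to signs, which do not matter here.) -/
def IsPoincareQuadrature (μ : Measure ℝ) (a b : ℝ) {n : ℕ} (X w : Fin n → ℝ) : Prop :=
  ∃ φ : ℕ → ℝ → ℝ, IsPoincareBasis μ a b φ ∧ IsGaussQuadrature μ a b φ X w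

end PoincareQuadrature

/-!
The eigenfunctions of the weak spectral problem on `[a, b]` are, up to multiples, the cosines
`cos (m π (x - a) / (b - a))`, with the distinct eigenvalues `(m π / (b - a))²`. Indeed every
element of `H¹` is absolutely continuous (`MemH1.exists_absolutelyContinuous`, from the lemma of
du Bois-Reymond), so it can be integrated by parts against a cosine; hence an eigenfunction is
orthogonal to every cosine with a different eigenvalue, and by completeness of the cosines
(Weierstrass' theorem in the variable `u = cos (π (x - a) / (b - a))`) it is a multiple of a single
one. Since the eigenvalues of a Poincaré basis increase strictly and no cosine can be missing, the
`m`-th function of the basis is a multiple of the `m`-th cosine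
(`IsPoincareBasis.exists_eq_mul_neumannCos`).

In the variable `u` the cosines are the Chebyshev polynomials. So the Poincaré quadrature is the
Gaussian quadrature for polynomials of degree less than `2 n` in `u`, which is unique, and is given
by the Chebyshev nodes with equal weights. In the variable `x` this is the midpoint rule
(`isPoincareQuadrature_iff_eq`).

With `h = (b - a) / (2 n)`, the error of the midpoint rule is represented in `H¹` by the function
`g x = 1 - (h / sinh h) cosh d`, where `d` is the distance from `x` to the nearest end of a cell;
this is an integration by parts on each half cell (`MemH1.integral_mul_representer`). By
Cauchy–Schwarz the worst-case error is the norm of `g`, and `‖g‖²` is the error of the rule on `g`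
itself, that is `h / tanh h - 1` (`wce_midpointNode`). The asymptotic equivalence follows from
`h / tanh h - 1 ~ h² / 3`.
-/

namespace PoincareQuadrature

open MeasureTheory Set Filter Topology
open scoped ContDiff ENNReal

open Real (cos sin)

variable {a b : ℝ}

/-! ### The uniform distribution and sufficient conditions for membership in `H¹` -/

theorem uniform_eq_smul (hab : a < b) :
    uniform a b = ENNReal.ofReal (b - a)⁻¹ • volume.restrict (Icc a b) := by
  rw [uniform, ProbabilityTheory.cond, Real.volume_Icc, ENNReal.ofReal_inv_of_pos (sub_pos.2 hab)]

theorem isProbabilityMeasure_uniform (hab : a < b) : IsProbabilityMeasure (uniform a b) :=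
  ProbabilityTheory.cond_isProbabilityMeasure_of_finite (by simp [hab]) (by simp)

theorem integral_uniform (hab : a < b) (f : ℝ → ℝ) :
    ∫ x, f x ∂uniform a b = (b - a)⁻¹ * ∫ x in a..b, f x := by
  rw [uniform_eq_smul hab, integral_smul_measure,
    ENNReal.toReal_ofReal (inv_nonneg.2 (sub_pos.2 hab).le), integral_Icc_eq_integral_Ioc,
    intervalIntegral.integral_of_le hab.le, smul_eq_mul]

theorem ae_uniform_eq (hab : a < b) : ae (uniform a b) = ae (volume.restrict (Icc a b)) := by
  rw [uniform_eq_smul hab]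
  refine Measure.ae_ennreal_smul_measure_eq ?_ _
  simpa using hab

theorem ae_mem_Icc_uniform : ∀ᵐ x ∂uniform a b, x ∈ Icc a b :=
  ProbabilityTheory.ae_cond_mem measurableSet_Icc

theorem memLp_uniform_iff (hab : a < b) (p : ℝ≥0∞) (f : ℝ → ℝ) :
    MemLp f p (uniform a b) ↔ MemLp f p (volume.restrict (Icc a b)) := by
  rw [uniform_eq_smul hab]
  refine ⟨fun h => h.of_measure_le_smul (c := (ENNReal.ofReal (b - a)⁻¹)⁻¹) ?_ ?_,
    fun h => h.smul_measure ENNReal.ofReal_ne_top⟩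
  · simpa using hab
  · rw [smul_smul, ENNReal.inv_mul_cancel (by simpa using hab) ENNReal.ofReal_ne_top, one_smul]

theorem memLp_uniform_of_continuousOn (hab : a < b) {f : ℝ → ℝ} (hf : ContinuousOn f (Icc a b))
    (p : ℝ≥0∞) : MemLp f p (uniform a b) := by
  rw [memLp_uniform_iff hab]
  obtain ⟨C, hC⟩ := isCompact_Icc.exists_bound_of_continuousOn hf
  exact MemLp.of_bound (hf.aestronglyMeasurable measurableSet_Icc) C
    (ae_restrict_of_forall_mem measurableSet_Icc hC)

theorem intervalIntegrable_of_memLp_uniform (hab : a < b) {f : ℝ → ℝ}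
    (hf : MemLp f 2 (uniform a b)) : IntervalIntegrable f volume a b := by
  rw [memLp_uniform_iff hab] at hf
  rw [intervalIntegrable_iff_integrableOn_Icc_of_le hab.le]
  exact hf.integrable (by norm_num)

theorem integral_Ioo_eq (hab : a < b) (f : ℝ → ℝ) :
    ∫ x in Ioo a b, f x = ∫ x in a..b, f x := by
  rw [intervalIntegral.integral_of_le hab.le, integral_Ioc_eq_integral_Ioo]

theorem eq_zero_of_tsupport_subset_Ioo {ψ : ℝ → ℝ} (h : tsupport ψ ⊆ Ioo a b) {x : ℝ}
    (hx : x ∉ Ioo a b) : ψ x = 0 :=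
  image_eq_zero_of_notMem_tsupport fun hx' => hx (h hx')

/-- A continuous function which is differentiable outside a countable set, with a
square-integrable derivative, lies in `H¹`. -/
theorem memH1_of_hasDerivAt_off_countable (hab : a < b) {f f' : ℝ → ℝ} {s : Set ℝ}
    (hs : s.Countable) (hf : ContinuousOn f (Icc a b))
    (hd : ∀ x ∈ Ioo a b \ s, HasDerivAt f (f' x) x) (hf' : MemLp f' 2 (uniform a b)) :
    MemH1 (uniform a b) a b f f' := by
  have hi := intervalIntegrable_of_memLp_uniform hab hf'
  have hi' := (intervalIntegrable_iff_integrableOn_Icc_of_le hab.le).1 hi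
  refine ⟨hf, memLp_uniform_of_continuousOn hab hf 2, hf', ?_, ?_, ?_⟩
  · exact ((hf.integrableOn_Icc).mono_set Ioo_subset_Icc_self).locallyIntegrableOn
  · exact (hi'.mono_set Ioo_subset_Icc_self).locallyIntegrableOn
  · intro ψ hψ _ hsupp
    rw [integral_Ioo_eq hab, integral_Ioo_eq hab]
    have hψ' : Continuous (deriv ψ) := hψ.continuous_deriv (by simp)
    have hfu : ContinuousOn f (uIcc a b) := by rwa [uIcc_of_le hab.le]
    have h1 : IntervalIntegrable (fun x => f' x * ψ x) volume a b :=
      hi.mul_continuousOn hψ.continuous.continuousOn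
    have h2 : IntervalIntegrable (fun x => f x * deriv ψ x) volume a b :=
      (hfu.mul hψ'.continuousOn).intervalIntegrable
    have := integral_eq_of_hasDerivAt_off_countable_of_le (fun x => f x * ψ x)
      (fun x => f' x * ψ x + f x * deriv ψ x) hab.le hs (hf.mul hψ.continuous.continuousOn)
      (fun x hx => (hd x hx).mul (hψ.differentiable (by simp) x).hasDerivAt) (h1.add h2)
    rw [eq_zero_of_tsupport_subset_Ioo hsupp (x := a) (by simp),
      eq_zero_of_tsupport_subset_Ioo hsupp (x := b) (by simp),
      intervalIntegral.integral_add h1 h2] at this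
    linarith

theorem memH1_of_contDiff (hab : a < b) {f : ℝ → ℝ} (hf : ContDiff ℝ 1 f) :
    MemH1 (uniform a b) a b f (deriv f) :=
  memH1_of_hasDerivAt_off_countable hab countable_empty hf.continuous.continuousOn
    (fun x _ => (hf.differentiable (by simp) x).hasDerivAt)
    (memLp_uniform_of_continuousOn hab (hf.continuous_deriv (by simp)).continuousOn 2)

/-! ### Absolute continuity of the elements of `H¹` -/

/-- A test function on `(a, b)` of integral zero is the derivative of a test function. -/
theorem exists_test_primitive (hab : a < b) {η : ℝ → ℝ} (hη : ContDiff ℝ ∞ η)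
    (hc : HasCompactSupport η) (hsupp : tsupport η ⊆ Ioo a b) (h0 : ∫ x, η x = 0) :
    ∃ ψ : ℝ → ℝ, ContDiff ℝ ∞ ψ ∧ HasCompactSupport ψ ∧ tsupport ψ ⊆ Ioo a b ∧ deriv ψ = η := by
  obtain ⟨c, d, hcd, hsub⟩ : ∃ c d, Icc c d ⊆ Ioo a b ∧ tsupport η ⊆ Icc c d := by
    rcases (tsupport η).eq_empty_or_nonempty with h | h
    · exact ⟨(a + b) / 2, (a + b) / 2, by simp; constructor <;> linarith, by simp [h]⟩
    · refine ⟨sInf (tsupport η), sSup (tsupport η), ?_, ?_⟩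
      · exact Icc_subset_Ioo (hsupp (hc.isCompact.sInf_mem h)).1
          (hsupp (hc.isCompact.sSup_mem h)).2
      · exact fun x hx => ⟨csInf_le hc.isCompact.bddBelow hx, le_csSup hc.isCompact.bddAbove hx⟩
  have hz : ∀ x, x ∉ Icc c d → η x = 0 := fun x hx =>
    image_eq_zero_of_notMem_tsupport fun h => hx (hsub h)
  have hderiv : ∀ x, HasDerivAt (fun x => ∫ t in a..x, η t) (η x) x := fun x =>
    intervalIntegral.integral_hasDerivAt_right (hη.continuous.intervalIntegrable _ _)
      (hη.continuous.stronglyMeasurableAtFilter _ _) hη.continuous.continuousAt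
  have hd : deriv (fun x => ∫ t in a..x, η t) = η := funext fun x => (hderiv x).deriv
  have htot : ∫ t in a..b, η t = 0 := by
    rw [intervalIntegral.integral_of_le hab.le, setIntegral_eq_integral_of_forall_compl_eq_zero, h0]
    exact fun x hx => hz x fun h => hx (Ioo_subset_Ioc_self (hcd h))
  have hsup : tsupport (fun x => ∫ t in a..x, η t) ⊆ Icc c d := by
    refine closure_minimal (fun x hx => ?_) isClosed_Icc
    by_contra hxn
    refine hx ?_
    by_cases hxc : x < c
    · have : ∀ t ∈ uIcc a x, η t = 0 := by
        intro t ht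
        by_cases htc : t ∈ Icc c d
        · have := (hcd htc).1
          rcases le_total a x with h | h
          · rw [uIcc_of_le h] at ht; linarith [ht.2, htc.1]
          · rw [uIcc_of_ge h] at ht; linarith [ht.2]
        · exact hz t htc
      simp [intervalIntegral.integral_congr this]
    · have hxd : d < x := by
        by_contra h
        exact hxn ⟨not_lt.1 hxc, not_lt.1 h⟩
      have : ∀ t ∈ uIcc b x, η t = 0 := by
        intro t ht
        by_cases htc : t ∈ Icc c d
        · have := (hcd htc).2
          rcases le_total b x with h | h
          · rw [uIcc_of_le h] at ht; linarith [ht.1]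
          · rw [uIcc_of_ge h] at ht; linarith [ht.1, htc.2]
        · exact hz t htc
      show ∫ t in a..x, η t = 0
      rw [← intervalIntegral.integral_add_adjacent_intervals
        (hη.continuous.intervalIntegrable a b) (hη.continuous.intervalIntegrable b x), htot,
        intervalIntegral.integral_congr this]
      simp
  refine ⟨_, ?_, ?_, hsup.trans hcd, hd⟩
  · rw [contDiff_infty_iff_deriv]
    exact ⟨fun x => (hderiv x).differentiableAt, by rwa [hd]⟩
  · exact HasCompactSupport.of_support_subset_isCompact isCompact_Icc
      ((subset_tsupport _).trans hsup)

/-- The lemma of du Bois-Reymond: a function whose weak derivative on `(a, b)` vanishes is almost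
everywhere constant. -/
theorem exists_ae_eq_const_of_integral_mul_deriv_eq_zero (hab : a < b) {u : ℝ → ℝ}
    (hu : LocallyIntegrableOn u (Ioo a b))
    (h : ∀ ψ : ℝ → ℝ, ContDiff ℝ ∞ ψ → HasCompactSupport ψ → tsupport ψ ⊆ Ioo a b →
      ∫ x, u x * deriv ψ x = 0) :
    ∃ C : ℝ, ∀ᵐ x, x ∈ Ioo a b → u x = C := by
  let ρ : ContDiffBump ((a + b) / 2) := ⟨(b - a) / 8, (b - a) / 4, by linarith, by linarith⟩
  let r : ℝ → ℝ := ρ.normed volume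
  have hr : ContDiff ℝ ∞ r := ρ.contDiff_normed
  have hrc : HasCompactSupport r := ρ.hasCompactSupport_normed
  have hrs : tsupport r ⊆ Ioo a b := by
    rw [ρ.tsupport_normed_eq, Real.closedBall_eq_Icc]
    refine Icc_subset_Ioo ?_ ?_ <;> simp only [ρ] <;> linarith
  have hr1 : ∫ x, r x = 1 := ρ.integral_normed
  have hmul : ∀ η : ℝ → ℝ, ContDiff ℝ ∞ η → HasCompactSupport η → tsupport η ⊆ Ioo a b →
      Integrable (fun x => u x * η x) := by
    intro η hη hηc hηs
    have h1 : IntegrableOn u (tsupport η) := hu.integrableOn_compact_subset hηs hηc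
    have h2 : IntegrableOn (fun x => u x * η x) (tsupport η) :=
      h1.mul_continuousOn hη.continuous.continuousOn hηc
    refine (integrableOn_iff_integrable_of_support_subset fun x hx => ?_).1 h2
    exact subset_tsupport _ (right_ne_zero_of_mul hx)
  refine ⟨∫ x, u x * r x, ?_⟩
  have hloc : LocallyIntegrableOn (fun x => u x - ∫ x, u x * r x) (Ioo a b) :=
    hu.sub ((locallyIntegrable_const _).locallyIntegrableOn _)
  have := isOpen_Ioo.ae_eq_zero_of_integral_contDiff_smul_eq_zero hloc ?_
  · filter_upwards [this] with x hx hxm using sub_eq_zero.1 (hx hxm)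
  intro η hη hηc hηs
  -- Subtracting a multiple of a fixed bump of integral one makes the test function a derivative.
  set m := ∫ x, η x with hm
  have hζ : ContDiff ℝ ∞ (fun x => η x - m * r x) := hη.sub (contDiff_const.mul hr)
  have hζs' : tsupport (fun x => η x - m * r x) ⊆ tsupport η ∪ tsupport r := by
    refine closure_minimal (fun x hx => ?_) ((isClosed_tsupport _).union (isClosed_tsupport _))
    by_contra hx'
    rw [mem_union, not_or] at hx'
    exact hx (by simp [image_eq_zero_of_notMem_tsupport hx'.1,
      image_eq_zero_of_notMem_tsupport hx'.2])
  have hζc : HasCompactSupport (fun x => η x - m * r x) :=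
    (hηc.isCompact.union hrc.isCompact).of_isClosed_subset (isClosed_tsupport _) hζs'
  have hηi : Integrable η := hη.continuous.integrable_of_hasCompactSupport hηc
  have hri : Integrable r := hr.continuous.integrable_of_hasCompactSupport hrc
  obtain ⟨ψ, hψ, hψc, hψs, hψd⟩ := exists_test_primitive hab hζ hζc
    (hζs'.trans (union_subset hηs hrs)) (by
      rw [integral_sub hηi (hri.const_mul m), integral_const_mul, hr1, mul_one, sub_self])
  have h0 := h ψ hψ hψc hψs
  rw [hψd] at h0
  have e1 : (fun x => u x * (η x - m * r x)) = fun x => u x * η x - m * (u x * r x) := by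
    ext x; ring
  rw [e1, integral_sub (hmul η hη hηc hηs) ((hmul r hr hrc hrs).const_mul m),
    integral_const_mul] at h0
  have e2 : (fun x => η x • (u x - ∫ x, u x * r x)) =
      fun x => u x * η x - (∫ x, u x * r x) * η x := by
    ext x; simp only [smul_eq_mul]; ring
  rw [e2, integral_sub (hmul η hη hηc hηs) (hηi.const_mul _), integral_const_mul, ← hm]
  linarith

/-- An element of `H¹` is absolutely continuous, and its weak derivative is its almost everywhere
derivative. The absolutely continuous function `F` agrees with `f` on `[a, b]` only, as the values
of `f` elsewhere are arbitrary. -/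
theorem MemH1.exists_absolutelyContinuous (hab : a < b) {f f' : ℝ → ℝ}
    (hf : MemH1 (uniform a b) a b f f') :
    ∃ F : ℝ → ℝ, AbsolutelyContinuousOnInterval F a b ∧ EqOn f F (Icc a b) ∧
      ∀ᵐ x, x ∈ Icc a b → deriv F x = f' x := by
  have hi := intervalIntegrable_of_memLp_uniform hab hf.memLp_deriv
  set G : ℝ → ℝ := fun x => ∫ t in a..x, f' t with hG
  have hGac : AbsolutelyContinuousOnInterval G a b :=
    hi.absolutelyContinuousOnInterval_intervalIntegral (by simp)
  have hGd : ∀ᵐ x, x ∈ Icc a b → deriv G x = f' x := by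
    filter_upwards [hi.ae_hasDerivAt_integral] with x hx hxm
    exact (hx (by rwa [uIcc_of_le hab.le]) a (by simp)).deriv
  have hGc : ContinuousOn G (Icc a b) := by
    have := hGac.continuousOn
    rwa [uIcc_of_le hab.le] at this
  have hloc : LocallyIntegrableOn (fun x => f x - G x) (Ioo a b) :=
    (((hf.continuousOn.sub hGc).integrableOn_Icc).mono_set Ioo_subset_Icc_self).locallyIntegrableOn
  obtain ⟨C, hC⟩ := exists_ae_eq_const_of_integral_mul_deriv_eq_zero hab hloc (by
    intro ψ hψ hψc hψs
    have hψ' : Continuous (deriv ψ) := hψ.continuous_deriv (by simp)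
    have hw := hf.hasWeakDerivOn.integral_eq ψ hψ hψc hψs
    rw [integral_Ioo_eq hab, integral_Ioo_eq hab] at hw
    have hψac : AbsolutelyContinuousOnInterval ψ a b :=
      ContDiffOn.absolutelyContinuousOnInterval (hψ.of_le (by simp)).contDiffOn
    have hp := hGac.integral_mul_deriv_eq_deriv_mul hψac
    rw [eq_zero_of_tsupport_subset_Ioo hψs (x := a) (by simp),
      eq_zero_of_tsupport_subset_Ioo hψs (x := b) (by simp)] at hp
    have hp2 : ∫ x in a..b, deriv G x * ψ x = ∫ x in a..b, f' x * ψ x := by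
      refine intervalIntegral.integral_congr_ae ?_
      filter_upwards [hGd] with x hx hxm
      rw [uIoc_of_le hab.le] at hxm
      rw [hx (Ioc_subset_Icc_self hxm)]
    have h0 : ∫ x, (f x - G x) * deriv ψ x = ∫ x in Ioo a b, (f x - G x) * deriv ψ x := by
      refine (setIntegral_eq_integral_of_forall_compl_eq_zero fun x hx => ?_).symm
      rw [eq_zero_of_tsupport_subset_Ioo (tsupport_deriv_subset.trans hψs) hx, mul_zero]
    have hfc : ContinuousOn f (uIcc a b) := by rw [uIcc_of_le hab.le]; exact hf.continuousOn
    have h1 : IntervalIntegrable (fun x => f x * deriv ψ x) volume a b :=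
      (hfc.mul hψ'.continuousOn).intervalIntegrable
    have h2 : IntervalIntegrable (fun x => G x * deriv ψ x) volume a b :=
      (hGac.continuousOn.mul hψ'.continuousOn).intervalIntegrable
    rw [h0, integral_Ioo_eq hab]
    simp only [sub_mul]
    rw [intervalIntegral.integral_sub h1 h2, hw, hp, hp2]
    ring)
  have hEq : EqOn f (fun x => G x + C) (Icc a b) := by
    refine Measure.eqOn_Icc_of_ae_eq volume hab.ne ?_ hf.continuousOn
      (hGc.add continuousOn_const)
    rw [← restrict_Ioo_eq_restrict_Icc]
    rw [EventuallyEq, ae_restrict_iff' measurableSet_Ioo]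
    filter_upwards [hC] with x hx hxm
    linarith [hx hxm]
  refine ⟨fun x => G x + C, ?_, hEq, ?_⟩
  · exact hGac.fun_add
      (ContDiffOn.absolutelyContinuousOnInterval (contDiff_const (n := 1)).contDiffOn)
  · filter_upwards [hGd] with x hx hxm
    rw [deriv_add_const, hx hxm]

/-- Integration by parts of an element of `H¹` against a `C¹` function on a subinterval. -/
theorem MemH1.integral_mul_deriv_eq (hab : a < b) {f f' : ℝ → ℝ}
    (hf : MemH1 (uniform a b) a b f f') {v : ℝ → ℝ} (hv : ContDiff ℝ 1 v) {c d : ℝ}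
    (hc : c ∈ Icc a b) (hd : d ∈ Icc a b) :
    ∫ x in c..d, f x * deriv v x = f d * v d - f c * v c - ∫ x in c..d, f' x * v x := by
  obtain ⟨F, hF, hfF, hFd⟩ := hf.exists_absolutelyContinuous hab
  have hsub : uIcc c d ⊆ Icc a b := uIcc_subset_Icc hc hd
  have hF' : AbsolutelyContinuousOnInterval F c d := hF.mono (by rwa [uIcc_of_le hab.le])
  have hv' : AbsolutelyContinuousOnInterval v c d :=
    ContDiffOn.absolutelyContinuousOnInterval hv.contDiffOn
  have := hF'.integral_mul_deriv_eq_deriv_mul hv'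
  rw [← hfF hc, ← hfF hd] at this
  rw [intervalIntegral.integral_congr (g := fun x => F x * deriv v x)
    (fun x hx => by simp only [hfF (hsub hx)]), this]
  congr 1
  refine intervalIntegral.integral_congr_ae ?_
  filter_upwards [hFd] with x hx hxm
  rw [hx (hsub (uIoc_subset_uIcc hxm))]

/-! ### The Neumann cosines: spectral problem, orthonormality and completeness -/

/-- The `m`-th cosine `cos (m π (x - a) / (b - a))`, normalized in `L²` of the uniform distribution
on `[a, b]`: these are the eigenfunctions of the Laplacian with Neumann boundary conditions. -/
noncomputable def neumannCos (a b : ℝ) (m : ℕ) (x : ℝ) : ℝ :=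
  (if m = 0 then 1 else √2) * cos (m * (Real.pi * (x - a) / (b - a)))

/-- The eigenvalue belonging to `neumannCos a b m`. -/
noncomputable def neumannEigenvalue (a b : ℝ) (m : ℕ) : ℝ := (m * Real.pi / (b - a)) ^ 2

theorem contDiff_neumannCos (m : ℕ) {k : WithTop ℕ∞} : ContDiff ℝ k (neumannCos a b m) := by
  unfold neumannCos; fun_prop

theorem neumannCos_zero (x : ℝ) : neumannCos a b 0 x = 1 := by simp [neumannCos]

theorem hasDerivAt_angle (m : ℕ) (x : ℝ) :
    HasDerivAt (fun x => (m : ℝ) * (Real.pi * (x - a) / (b - a))) (m * Real.pi / (b - a)) x :=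
  (((((hasDerivAt_id' x).sub_const a).const_mul Real.pi).div_const (b - a)).const_mul
    (m : ℝ)).congr_deriv (by ring)

theorem deriv_neumannCos (m : ℕ) : deriv (neumannCos a b m) = fun x =>
    (if m = 0 then 1 else √2) *
      (-sin (m * (Real.pi * (x - a) / (b - a))) * (m * Real.pi / (b - a))) := by
  ext x
  have h := hasDerivAt_angle (a := a) (b := b) m x
  exact (h.cos.const_mul _).deriv

theorem deriv_deriv_neumannCos (m : ℕ) : deriv (deriv (neumannCos a b m)) = fun x =>
    -(neumannEigenvalue a b m * neumannCos a b m x) := by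
  rw [deriv_neumannCos]
  ext x
  have h := hasDerivAt_angle (a := a) (b := b) m x
  rw [((h.sin.fun_neg.mul_const _).const_mul _).deriv, neumannEigenvalue, neumannCos]
  ring

theorem strictMono_neumannEigenvalue (hab : a < b) : StrictMono (neumannEigenvalue a b) := by
  intro m k hmk
  have hba := sub_pos.2 hab
  have hmk' : (m : ℝ) < k := by exact_mod_cast hmk
  unfold neumannEigenvalue
  gcongr

theorem memH1_neumannCos (hab : a < b) (m : ℕ) :
    MemH1 (uniform a b) a b (neumannCos a b m) (deriv (neumannCos a b m)) :=
  memH1_of_contDiff hab (contDiff_neumannCos m)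

/-- The cosines solve the weak spectral problem: they satisfy the Neumann boundary conditions, so
that no boundary terms appear in the integration by parts. -/
theorem integral_deriv_neumannCos_mul (hab : a < b) (m : ℕ) {g g' : ℝ → ℝ}
    (hg : MemH1 (uniform a b) a b g g') :
    ∫ x, deriv (neumannCos a b m) x * g' x ∂uniform a b =
      neumannEigenvalue a b m * ∫ x, neumannCos a b m x * g x ∂uniform a b := by
  have hv : ContDiff ℝ 1 (deriv (neumannCos a b m)) := by
    rw [deriv_neumannCos]; fun_prop
  have h := hg.integral_mul_deriv_eq hab hv (left_mem_Icc.2 hab.le) (right_mem_Icc.2 hab.le)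
  have ha : deriv (neumannCos a b m) a = 0 := by rw [deriv_neumannCos]; simp
  have hb : deriv (neumannCos a b m) b = 0 := by
    rw [deriv_neumannCos]
    simp [mul_div_assoc, div_self (sub_pos.2 hab).ne', Real.sin_nat_mul_pi]
  rw [ha, hb, deriv_deriv_neumannCos] at h
  have e : (fun x => g x * -(neumannEigenvalue a b m * neumannCos a b m x)) =
      fun x => -(neumannEigenvalue a b m) * (neumannCos a b m x * g x) := by ext x; ring
  rw [e, intervalIntegral.integral_const_mul] at h
  rw [integral_uniform hab, integral_uniform hab]
  simp only [mul_comm (deriv _ _)]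
  linear_combination (b - a)⁻¹ * h

theorem integral_neumannCos (hab : a < b) {m : ℕ} (hm : m ≠ 0) :
    ∫ x, neumannCos a b m x ∂uniform a b = 0 := by
  have h := integral_deriv_neumannCos_mul hab m
    (memH1_of_contDiff hab (contDiff_const (c := (1 : ℝ))))
  have hba := sub_pos.2 hab
  have hlam : neumannEigenvalue a b m ≠ 0 := by
    have : (m : ℝ) ≠ 0 := by exact_mod_cast hm
    unfold neumannEigenvalue
    have := Real.pi_pos.ne'
    have := hba.ne'
    positivity
  simpa [hlam] using h

theorem integral_neumannCos_zero (hab : a < b) :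
    ∫ x, neumannCos a b 0 x ∂uniform a b = 1 := by
  have := isProbabilityMeasure_uniform hab
  simp [neumannCos_zero]

theorem integral_neumannCos_mul (hab : a < b) (m k : ℕ) :
    ∫ x, neumannCos a b m x * neumannCos a b k x ∂uniform a b = if m = k then 1 else 0 := by
  have := isProbabilityMeasure_uniform hab
  split_ifs with h
  · subst h
    rcases eq_or_ne m 0 with rfl | hm
    · simp [neumannCos_zero]
    have e : (fun x => neumannCos a b m x * neumannCos a b m x) =
        fun x => 1 + (√2)⁻¹ * neumannCos a b (2 * m) x := by
      ext x
      have h2 : √2 ≠ 0 := by positivity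
      have hs : √2 * √2 = 2 := Real.mul_self_sqrt (by norm_num)
      simp only [neumannCos, hm, if_false, mul_eq_zero, OfNat.ofNat_ne_zero, or_self,
        inv_mul_cancel_left₀ h2]
      push_cast
      rw [mul_assoc 2, Real.cos_two_mul]
      linear_combination cos (m * (Real.pi * (x - a) / (b - a))) ^ 2 * hs
    rw [e, integral_add (integrable_const _), integral_const_mul,
      integral_neumannCos hab (by positivity)]
    · simp
    · exact ((memH1_neumannCos hab (2 * m)).memLp.integrable (by norm_num)).const_mul _
  · have h1 := integral_deriv_neumannCos_mul hab m (memH1_neumannCos hab k)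
    have h2 := integral_deriv_neumannCos_mul hab k (memH1_neumannCos hab m)
    simp only [mul_comm (deriv (neumannCos a b k) _), mul_comm (neumannCos a b k _)] at h2
    have h3 : neumannEigenvalue a b m - neumannEigenvalue a b k ≠ 0 :=
      sub_ne_zero.2 fun h' => h ((strictMono_neumannEigenvalue hab).injective h')
    refine (mul_eq_zero.1 ?_).resolve_left h3
    linear_combination h2 - h1

theorem eval_T_cos_eq_neumannCos (m : ℕ) (x : ℝ) :
    (Polynomial.Chebyshev.T ℝ m).eval (cos (Real.pi * (x - a) / (b - a))) =
      (if m = 0 then 1 else √2)⁻¹ * neumannCos a b m x := by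
  have h : (if m = 0 then (1 : ℝ) else √2) ≠ 0 := by split_ifs <;> positivity
  rw [Polynomial.Chebyshev.T_real_cos, neumannCos, inv_mul_cancel_left₀ h]
  simp

theorem mem_Icc_angle (hab : a < b) {x : ℝ} (hx : x ∈ Icc a b) :
    Real.pi * (x - a) / (b - a) ∈ Icc 0 Real.pi := by
  have hba := sub_pos.2 hab
  have := Real.pi_pos
  have h1 := sub_nonneg.2 hx.1
  refine ⟨by positivity, ?_⟩
  rw [div_le_iff₀ hba]
  gcongr
  exact hx.2

/-- The cosines are complete: by Weierstrass' theorem polynomials in `cos (π (x - a) / (b - a))`,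
which are combinations of the cosines, approximate every continuous function. -/
theorem ae_eq_zero_of_integral_mul_neumannCos_eq_zero (hab : a < b) {f : ℝ → ℝ}
    (hf : MemLp f 2 (uniform a b))
    (h : ∀ m, ∫ x, f x * neumannCos a b m x ∂uniform a b = 0) : f =ᵐ[uniform a b] 0 := by
  have := isProbabilityMeasure_uniform hab
  have hba := sub_pos.2 hab
  have hfi : Integrable f (uniform a b) := hf.integrable (by norm_num)
  set U : ℝ → ℝ := fun x => cos (Real.pi * (x - a) / (b - a)) with hU
  have hUc : Continuous U := by fun_prop
  have hint : ∀ g : ℝ → ℝ, Continuous g → Integrable (fun x => f x * g x) (uniform a b) :=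
    fun g hg => hf.integrable_mul (memLp_uniform_of_continuousOn hab hg.continuousOn 2)
  have hintp : ∀ p : Polynomial ℝ, Integrable (fun x => f x * p.eval (U x)) (uniform a b) :=
    fun p => hint (fun x => p.eval (U x)) (p.continuous.comp hUc)
  have hpoly : ∀ p : Polynomial ℝ, ∫ x, f x * p.eval (U x) ∂uniform a b = 0 := by
    intro p
    have hp : p ∈ Submodule.span ℝ (Set.range (Polynomial.Chebyshev.chebyshevTsequence ℝ)) := by
      rw [Polynomial.Sequence.span _ (by simp)]; trivial
    induction hp using Submodule.span_induction with
    | mem q hq =>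
      obtain ⟨m, rfl⟩ := hq
      have e : (fun x => f x * ((Polynomial.Chebyshev.chebyshevTsequence ℝ) m).eval (U x)) =
          fun x => (if m = 0 then 1 else √2)⁻¹ * (f x * neumannCos a b m x) := by
        ext x
        have := eval_T_cos_eq_neumannCos (a := a) (b := b) m x
        simp only [Polynomial.Chebyshev.chebyshevTsequence, hU]
        rw [this]; ring
      rw [e, integral_const_mul, h, mul_zero]
    | zero => simp
    | add q r _ _ hq hr =>
      simp only [Polynomial.eval_add, mul_add]
      rw [integral_add (hintp q) (hintp r), hq, hr,
        add_zero]
    | smul c q _ hq =>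
      simp only [Polynomial.eval_smul, smul_eq_mul, mul_left_comm _ c]
      rw [integral_const_mul, hq, mul_zero]
  have hcont : ∀ η : ℝ → ℝ, Continuous η → ∫ x, f x * η x ∂uniform a b = 0 := by
    intro η hη
    refine abs_eq_zero.1 (le_antisymm ?_ (abs_nonneg _))
    refine le_of_forall_pos_le_add fun δ hδ => ?_
    set M := ∫ x, |f x| ∂uniform a b with hM
    have hM0 : 0 ≤ M := integral_nonneg fun _ => abs_nonneg _
    obtain ⟨p, hp⟩ := exists_polynomial_near_of_continuousOn (-1) 1
      (fun u => η (a + (b - a) * Real.arccos u / Real.pi)) (by fun_prop) (δ / (M + 1))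
      (by positivity)
    have e : ∫ x, f x * η x ∂uniform a b = ∫ x, f x * (η x - p.eval (U x)) ∂uniform a b := by
      simp only [mul_sub]
      rw [integral_sub (hint _ hη) (hintp p), hpoly, sub_zero]
    rw [e, zero_add]
    calc |∫ x, f x * (η x - p.eval (U x)) ∂uniform a b|
        ≤ ∫ x, |f x| * (δ / (M + 1)) ∂uniform a b := by
          rw [← Real.norm_eq_abs]
          refine norm_integral_le_of_norm_le (hfi.abs.mul_const _) ?_
          filter_upwards [ae_mem_Icc_uniform] with x hx
          rw [norm_mul, Real.norm_eq_abs, Real.norm_eq_abs]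
          gcongr
          have h1 := hp (U x) ⟨Real.neg_one_le_cos _, Real.cos_le_one _⟩
          have hθ := mem_Icc_angle hab hx
          have h2 : a + (b - a) * Real.arccos (U x) / Real.pi = x := by
            simp only [hU]
            rw [Real.arccos_cos hθ.1 hθ.2]
            have := hba.ne'
            field_simp
            ring
          simp only [h2] at h1
          rw [abs_sub_comm]
          exact h1.le
      _ = M * (δ / (M + 1)) := integral_mul_const _ _
      _ ≤ δ := by
          rw [mul_div_assoc', div_le_iff₀ (by positivity)]
          nlinarith
  have hloc : LocallyIntegrableOn f (Ioo a b) := by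
    have := (intervalIntegrable_iff_integrableOn_Icc_of_le hab.le).1
      (intervalIntegrable_of_memLp_uniform hab hf)
    exact (this.mono_set Ioo_subset_Icc_self).locallyIntegrableOn
  have hz := isOpen_Ioo.ae_eq_zero_of_integral_contDiff_smul_eq_zero hloc (by
    intro η hη _ hηs
    have h1 := hcont η hη.continuous
    rw [integral_uniform hab, ← integral_Ioo_eq hab] at h1
    have h2 := (mul_eq_zero.1 h1).resolve_left (inv_ne_zero hba.ne')
    rw [← h2, setIntegral_eq_integral_of_forall_compl_eq_zero]
    · simp only [smul_eq_mul, mul_comm]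
    · intro x hx
      rw [eq_zero_of_tsupport_subset_Ioo hηs hx, mul_zero])
  rw [EventuallyEq, ae_uniform_eq hab, ← restrict_Ioo_eq_restrict_Icc,
    ae_restrict_iff' measurableSet_Ioo]
  exact hz

/-! ### Poincaré bases consist of multiples of the cosines -/

theorem inner_Lp_eq_integral {μ : Measure ℝ} {F G : Lp ℝ 2 μ} {f g : ℝ → ℝ} (hf : F =ᵐ[μ] f)
    (hg : G =ᵐ[μ] g) : inner ℝ F G = ∫ x, f x * g x ∂μ := by
  rw [L2.inner_def]
  refine integral_congr_ae ?_
  filter_upwards [hf, hg] with x hx hy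
  rw [hx, hy]
  simp [mul_comm]

/-- The cosines, as elements of `L²` of the uniform distribution. -/
noncomputable def neumannCosLp (hab : a < b) (m : ℕ) : Lp ℝ 2 (uniform a b) :=
  (memH1_neumannCos hab m).memLp.toLp

theorem coeFn_neumannCosLp (hab : a < b) (m : ℕ) :
    neumannCosLp hab m =ᵐ[uniform a b] neumannCos a b m :=
  MemLp.coeFn_toLp _

theorem orthonormal_neumannCosLp (hab : a < b) : Orthonormal ℝ (neumannCosLp hab) := by
  rw [orthonormal_iff_ite]
  intro m k
  rw [inner_Lp_eq_integral (coeFn_neumannCosLp hab m) (coeFn_neumannCosLp hab k),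
    integral_neumannCos_mul hab]

theorem orthogonal_span_neumannCosLp (hab : a < b) :
    (Submodule.span ℝ (range (neumannCosLp hab)))ᗮ = ⊥ := by
  rw [Submodule.eq_bot_iff]
  intro F hF
  rw [Lp.eq_zero_iff_ae_eq_zero]
  refine ae_eq_zero_of_integral_mul_neumannCos_eq_zero hab (Lp.memLp F) fun m => ?_
  rw [← inner_Lp_eq_integral (ae_eq_refl _) (coeFn_neumannCosLp hab m)]
  exact Submodule.inner_left_of_mem_orthogonal (Submodule.subset_span (mem_range_self m)) hF

theorem isPoincareBasis_neumannCos (hab : a < b) :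
    IsPoincareBasis (uniform a b) a b (neumannCos a b) where
  eigen := ⟨neumannEigenvalue a b, strictMono_neumannEigenvalue hab, fun m =>
    ⟨_, memH1_neumannCos hab m, fun _ _ hg => integral_deriv_neumannCos_mul hab m hg⟩⟩
  hilbertBasis := by
    refine ⟨HilbertBasis.mkOfOrthogonalEqBot (orthonormal_neumannCosLp hab)
      (orthogonal_span_neumannCosLp hab), fun m => ?_⟩
    rw [HilbertBasis.coe_mkOfOrthogonalEqBot]
    exact coeFn_neumannCosLp hab m
  zero_eq_one := fun x _ => neumannCos_zero x

/-- A nonzero solution of the spectral problem is a multiple of a cosine: pairing with each of the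
cosines, whose eigenvalues are distinct, shows that it is orthogonal to all of them but one. -/
theorem SolvesSpectral.exists_eq_mul_neumannCos (hab : a < b) {lam : ℝ} {f : ℝ → ℝ}
    (hf : SolvesSpectral (uniform a b) a b lam f) (h0 : ¬ f =ᵐ[uniform a b] 0) :
    ∃ k, lam = neumannEigenvalue a b k ∧
      ∃ α : ℝ, α ≠ 0 ∧ ∀ x ∈ Icc a b, f x = α * neumannCos a b k x := by
  obtain ⟨f', hf1, hs⟩ := hf
  have horth : ∀ k, lam = neumannEigenvalue a b k ∨
      ∫ x, f x * neumannCos a b k x ∂uniform a b = 0 := by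
    intro k
    have h1 := hs _ _ (memH1_neumannCos hab k)
    have h2 := integral_deriv_neumannCos_mul hab k hf1
    simp only [mul_comm (deriv _ _), mul_comm (neumannCos a b k _)] at h2
    rw [h1] at h2
    rw [← sub_eq_zero (a := lam), ← mul_eq_zero]
    linear_combination h2
  obtain ⟨k, hk⟩ : ∃ k, ∫ x, f x * neumannCos a b k x ∂uniform a b ≠ 0 := by
    by_contra! h
    exact h0 (ae_eq_zero_of_integral_mul_neumannCos_eq_zero hab hf1.memLp h)
  have hlam := (horth k).resolve_right hk
  set α := ∫ x, f x * neumannCos a b k x ∂uniform a b with hα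
  refine ⟨k, hlam, α, hk, ?_⟩
  have hint : ∀ {g h : ℝ → ℝ}, MemLp g 2 (uniform a b) → MemLp h 2 (uniform a b) →
      Integrable (fun x => g x * h x) (uniform a b) := fun hg hh => hg.integrable_mul hh
  have hcos := fun j => (memH1_neumannCos hab j).memLp
  have hz := ae_eq_zero_of_integral_mul_neumannCos_eq_zero hab
    (f := fun x => f x - α * neumannCos a b k x) (hf1.memLp.sub ((hcos k).const_mul α)) (by
      intro j
      simp only [sub_mul, mul_assoc]
      rw [integral_sub (hint hf1.memLp (hcos j)) ((hint (hcos k) (hcos j)).const_mul α),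
        integral_const_mul, integral_neumannCos_mul hab]
      split_ifs with hkj
      · rw [← hkj, ← hα]; ring
      · rw [(horth j).resolve_left fun h =>
          hkj ((strictMono_neumannEigenvalue hab).injective (hlam.symm.trans h))]
        ring)
  refine Measure.eqOn_Icc_of_ae_eq volume hab.ne ?_ hf1.continuousOn
    (continuousOn_const.mul (contDiff_neumannCos (k := 0) k).continuous.continuousOn)
  rw [EventuallyEq, ← ae_uniform_eq hab]
  filter_upwards [hz] with x hx using sub_eq_zero.1 hx

/-- A Poincaré basis consists of nonzero multiples of the cosines, in the same order: no cosine can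
be missing, as it would be orthogonal to the whole basis. -/
theorem IsPoincareBasis.exists_eq_mul_neumannCos (hab : a < b) {φ : ℕ → ℝ → ℝ}
    (hφ : IsPoincareBasis (uniform a b) a b φ) (m : ℕ) :
    ∃ α : ℝ, α ≠ 0 ∧ ∀ x ∈ Icc a b, φ m x = α * neumannCos a b m x := by
  obtain ⟨lam, hlam, hs⟩ := hφ.eigen
  obtain ⟨B, hB⟩ := hφ.hilbertBasis
  have hne : ∀ m, ¬ φ m =ᵐ[uniform a b] 0 := fun m h =>
    B.orthonormal.ne_zero m ((Lp.eq_zero_iff_ae_eq_zero).2 ((hB m).trans h))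
  choose σ hσ α hα hφα using fun m => (hs m).exists_eq_mul_neumannCos hab (hne m)
  have hmono : StrictMono σ := by
    intro i j hij
    rw [← (strictMono_neumannEigenvalue hab).lt_iff_lt, ← hσ, ← hσ]
    exact hlam hij
  have hsurj : range σ = range (id : ℕ → ℕ) := by
    rw [range_id, eq_univ_iff_forall]
    intro k
    by_contra hk
    have h0 : neumannCosLp hab k = 0 := by
      refine B.repr.injective ?_
      rw [map_zero]
      ext i
      rw [B.repr_apply_apply, inner_Lp_eq_integral (hB i) (coeFn_neumannCosLp hab k)]
      have e : (fun x => φ i x * neumannCos a b k x) =ᵐ[uniform a b]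
          fun x => α i * (neumannCos a b (σ i) x * neumannCos a b k x) := by
        filter_upwards [ae_mem_Icc_uniform] with x hx
        rw [hφα i x hx, mul_assoc]
      rw [integral_congr_ae e, integral_const_mul, integral_neumannCos_mul hab,
        if_neg fun h => hk ⟨i, h⟩]
      simp
    exact (orthonormal_neumannCosLp hab).ne_zero k h0
  have hid : σ = id := (hmono.range_inj strictMono_id).1 hsurj
  refine ⟨α m, hα m, fun x hx => ?_⟩
  rw [hφα m x hx, hid, id]

/-- Every Poincaré basis has the same Gaussian quadratures as the cosines. -/
theorem isPoincareQuadrature_iff (hab : a < b) {n : ℕ} {X w : Fin n → ℝ} :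
    IsPoincareQuadrature (uniform a b) a b X w ↔
      IsGaussQuadrature (uniform a b) a b (neumannCos a b) X w := by
  refine ⟨?_, fun h => ⟨_, isPoincareBasis_neumannCos hab, h⟩⟩
  rintro ⟨φ, hφ, h⟩
  refine ⟨h.strictMono, h.mem_Icc, h.weight_pos, fun m hm => ?_⟩
  obtain ⟨α, hα, hφα⟩ := hφ.exists_eq_mul_neumannCos hab m
  have he := h.exact_integral m hm
  have e : φ m =ᵐ[uniform a b] fun x => α * neumannCos a b m x := by
    filter_upwards [ae_mem_Icc_uniform] with x hx using hφα x hx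
  rw [integral_congr_ae e, integral_const_mul] at he
  refine mul_left_cancel₀ hα (he.trans ?_)
  rw [Finset.mul_sum]
  refine Finset.sum_congr rfl fun i _ => ?_
  rw [hφα _ (h.mem_Icc i)]
  ring

/-! ### The Poincaré quadrature is the midpoint rule -/

open Polynomial in
/-- Two quadratures with `n` nodes which agree on polynomials of degree less than `2 n` have the
same nodes: if a node `v k` of the second one were not a node of the first, the polynomial
`∏ i, (X - u i) * ∏ j ≠ k, (X - v j)` would separate them. -/
theorem range_subset_range_of_sum_eval_eq {n : ℕ} {u v w w' : Fin n → ℝ}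
    (hv : Function.Injective v) (hw' : ∀ j, w' j ≠ 0)
    (h : ∀ p : ℝ[X], p.degree < 2 * n → ∑ i, w i * p.eval (u i) = ∑ j, w' j * p.eval (v j)) :
    range v ⊆ range u := by
  rintro _ ⟨k, rfl⟩
  by_contra hk
  set q : ℝ[X] := (∏ i, (X - C (u i))) * ∏ j ∈ Finset.univ.erase k, (X - C (v j)) with hq
  have hn : 0 < n := k.pos
  have hqd : q.degree < 2 * n := by
    rw [hq, degree_mul, degree_prod, degree_prod]
    simp only [degree_X_sub_C, Finset.sum_const, Finset.card_univ, Fintype.card_fin,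
      Finset.mem_univ, Finset.card_erase_of_mem]
    simp only [nsmul_eq_mul, mul_one]
    norm_cast
    lia
  have h1 : ∀ i, q.eval (u i) = 0 := fun i => by
    rw [hq, eval_mul, eval_prod, Finset.prod_eq_zero (Finset.mem_univ i) (by simp), zero_mul]
  have h2 : ∀ j, j ≠ k → q.eval (v j) = 0 := fun j hj => by
    rw [hq, eval_mul, eval_prod (Finset.univ.erase k),
      Finset.prod_eq_zero (Finset.mem_erase.2 ⟨hj, Finset.mem_univ j⟩) (by simp), mul_zero]
  have h3 := h q hqd
  simp only [h1, mul_zero, Finset.sum_const_zero] at h3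
  rw [Finset.sum_eq_single k (fun j _ hj => by rw [h2 j hj, mul_zero]) (by simp)] at h3
  have h4 : q.eval (v k) ≠ 0 := by
    rw [hq, eval_mul, eval_prod, eval_prod]
    refine mul_ne_zero (Finset.prod_ne_zero_iff.2 fun i _ => ?_)
      (Finset.prod_ne_zero_iff.2 fun j hj => ?_)
    · simpa [sub_eq_zero] using fun h => hk ⟨i, h.symm⟩
    · simpa [sub_eq_zero] using fun h => (Finset.ne_of_mem_erase hj) (hv h).symm
  exact mul_ne_zero (hw' k) h4 h3.symm

open Polynomial in
theorem weights_eq_of_sum_eval_eq {n : ℕ} {v w w' : Fin n → ℝ} (hv : Function.Injective v)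
    (h : ∀ p : ℝ[X], p.degree < 2 * n → ∑ i, w i * p.eval (v i) = ∑ j, w' j * p.eval (v j)) :
    w = w' := by
  ext k
  set q : ℝ[X] := ∏ j ∈ Finset.univ.erase k, (X - C (v j)) with hq
  have hn : 0 < n := k.pos
  have hqd : q.degree < 2 * n := by
    rw [hq, degree_prod]
    simp only [degree_X_sub_C, Finset.sum_const, Finset.card_univ, Fintype.card_fin,
      Finset.mem_univ, Finset.card_erase_of_mem]
    simp only [nsmul_eq_mul, mul_one]
    norm_cast
    lia
  have h2 : ∀ j, j ≠ k → q.eval (v j) = 0 := fun j hj => by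
    rw [hq, eval_prod (Finset.univ.erase k),
      Finset.prod_eq_zero (Finset.mem_erase.2 ⟨hj, Finset.mem_univ j⟩) (by simp)]
  have h3 := h q hqd
  rw [Finset.sum_eq_single k (fun j _ hj => by rw [h2 j hj, mul_zero]) (by simp),
    Finset.sum_eq_single k (fun j _ hj => by rw [h2 j hj, mul_zero]) (by simp)] at h3
  refine mul_right_cancel₀ ?_ h3
  rw [hq, eval_prod]
  refine Finset.prod_ne_zero_iff.2 fun j hj => ?_
  simpa [sub_eq_zero] using fun h => (Finset.ne_of_mem_erase hj) (hv h).symm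

open Polynomial in
/-- Exactness for the first `2 n` cosines is exactness for polynomials of degree less than `2 n` in
`cos (π (x - a) / (b - a))`. -/
theorem IsGaussQuadrature.integral_eval_eq (hab : a < b) {n : ℕ} {X w : Fin n → ℝ}
    (h : IsGaussQuadrature (uniform a b) a b (neumannCos a b) X w) (p : ℝ[X])
    (hp : p.degree < 2 * n) :
    ∫ x, p.eval (Real.cos (Real.pi * (x - a) / (b - a))) ∂uniform a b =
      ∑ i, w i * p.eval (Real.cos (Real.pi * (X i - a) / (b - a))) := by
  have hmem : p ∈ degreeLT ℝ (2 * n) := by rw [mem_degreeLT]; exact_mod_cast hp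
  rw [← Sequence.span_degreeLT (Chebyshev.chebyshevTsequence ℝ) (by simp)] at hmem
  have hint : ∀ q : ℝ[X], Integrable
      (fun x => q.eval (Real.cos (Real.pi * (x - a) / (b - a)))) (uniform a b) := fun q => by
    have := isProbabilityMeasure_uniform hab
    exact (memLp_uniform_of_continuousOn hab
      (q.continuous.comp (by fun_prop)).continuousOn 2).integrable (by norm_num)
  clear hp
  induction hmem using Submodule.span_induction with
  | mem q hq =>
    obtain ⟨m, hm, rfl⟩ := hq
    have e : ∀ x, ((Chebyshev.chebyshevTsequence ℝ) m).eval
        (Real.cos (Real.pi * (x - a) / (b - a))) =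
        (if m = 0 then 1 else √2)⁻¹ * neumannCos a b m x := fun x =>
      eval_T_cos_eq_neumannCos m x
    simp only [e]
    rw [integral_const_mul, h.exact_integral m hm, Finset.mul_sum]
    exact Finset.sum_congr rfl fun i _ => by ring
  | zero => simp
  | add q r _ _ hq hr =>
    simp only [eval_add, mul_add]
    rw [integral_add (hint q) (hint r), hq, hr, Finset.sum_add_distrib]
  | smul c q _ hq =>
    simp only [eval_smul, smul_eq_mul, mul_left_comm _ c]
    rw [integral_const_mul, hq, Finset.mul_sum]

theorem injOn_cos_angle (hab : a < b) :
    InjOn (fun x => Real.cos (Real.pi * (x - a) / (b - a))) (Icc a b) := by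
  intro x hx y hy hxy
  have hba := (sub_pos.2 hab).ne'
  have := Real.injOn_cos (mem_Icc_angle hab hx) (mem_Icc_angle hab hy) hxy
  field_simp at this
  linarith

theorem IsGaussQuadrature.unique (hab : a < b) {n : ℕ} {X w X' w' : Fin n → ℝ}
    (h : IsGaussQuadrature (uniform a b) a b (neumannCos a b) X w)
    (h' : IsGaussQuadrature (uniform a b) a b (neumannCos a b) X' w') : X = X' ∧ w = w' := by
  have key : ∀ {X w X' w' : Fin n → ℝ},
      IsGaussQuadrature (uniform a b) a b (neumannCos a b) X w →
      IsGaussQuadrature (uniform a b) a b (neumannCos a b) X' w' → range X' ⊆ range X := by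
    intro X w X' w' h h'
    rintro _ ⟨k, rfl⟩
    obtain ⟨i, hi⟩ := range_subset_range_of_sum_eval_eq
      (fun i j hij => h'.strictMono.injective
        (injOn_cos_angle hab (h'.mem_Icc i) (h'.mem_Icc j) hij))
      (fun j => (h'.weight_pos j).ne')
      (fun p hp => (h.integral_eval_eq hab p hp).symm.trans (h'.integral_eval_eq hab p hp))
      (mem_range_self k)
    exact ⟨i, injOn_cos_angle hab (h.mem_Icc i) (h'.mem_Icc k) hi⟩
  have hX : X = X' :=
    (h.strictMono.range_inj h'.strictMono).1 ((key h' h).antisymm (key h h'))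
  subst hX
  exact ⟨rfl, weights_eq_of_sum_eval_eq
    (fun i j hij => h.strictMono.injective
      (injOn_cos_angle hab (h.mem_Icc i) (h.mem_Icc j) hij))
    fun p hp => (h.integral_eval_eq hab p hp).symm.trans (h'.integral_eval_eq hab p hp)⟩

/-- The midpoints of the `n` intervals of equal length which make up `[a, b]`. -/
noncomputable def midpointNode (a b : ℝ) (n : ℕ) (i : Fin n) : ℝ :=
  a + (2 * i + 1) * ((b - a) / (2 * n))

/-- The midpoint rule is the Gaussian quadrature of the cosines; in the variable
`cos (π (x - a) / (b - a))` it is the Chebyshev–Gauss quadrature. -/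
theorem isGaussQuadrature_midpointNode (hab : a < b) {n : ℕ} (hn : 1 ≤ n) :
    IsGaussQuadrature (uniform a b) a b (neumannCos a b) (midpointNode a b n)
      (fun _ => (n : ℝ)⁻¹) := by
  have hba := sub_pos.2 hab
  have hn0 : (0 : ℝ) < n := by exact_mod_cast hn
  have hstep : 0 < (b - a) / (2 * n) := by positivity
  refine ⟨fun i j hij => ?_, fun i => ⟨?_, ?_⟩, fun _ => by positivity, fun m hm => ?_⟩
  · have : (i : ℝ) < j := by exact_mod_cast hij
    unfold midpointNode
    gcongr
  · have : 0 ≤ (2 * (i : ℝ) + 1) * ((b - a) / (2 * n)) := by positivity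
    unfold midpointNode
    linarith
  · have h1 : ((i : ℕ) : ℝ) + 1 ≤ n := by exact_mod_cast i.2
    have h2 : (2 * (i : ℝ) + 1) * ((b - a) / (2 * n)) ≤ (2 * n) * ((b - a) / (2 * n)) := by
      gcongr
      linarith
    rw [mul_div_cancel₀ _ (by positivity)] at h2
    unfold midpointNode
    linarith
  · have e : ∀ i : Fin n, (n : ℝ)⁻¹ * neumannCos a b m (midpointNode a b n i) =
        (n : ℝ)⁻¹ * (if m = 0 then 1 else √2) * (Polynomial.Chebyshev.T ℝ m).eval
          (Real.cos ((2 * ((i : ℕ) : ℝ) + 1) / (2 * n) * Real.pi)) := by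
      intro i
      rw [Polynomial.Chebyshev.T_real_cos, neumannCos, midpointNode, mul_assoc]
      congr 4
      have := hba.ne'
      field_simp
      ring
    simp only [e]
    rw [← Finset.mul_sum, Fin.sum_univ_eq_sum_range (fun i => (Polynomial.Chebyshev.T ℝ m).eval
          (Real.cos ((2 * (i : ℝ) + 1) / (2 * n) * Real.pi)))]
    rcases eq_or_ne m 0 with rfl | hm0
    · rw [integral_neumannCos_zero hab]
      simp [hn0.ne']
    · have h0 := Polynomial.Chebyshev.sumZeroes_T_of_not_dvd (n := n) (k := m) (by
        intro hd
        have := Int.le_of_dvd (by lia) hd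
        lia)
      rw [Polynomial.Chebyshev.sumZeroes] at h0
      rw [integral_neumannCos hab hm0,
        (mul_eq_zero.1 h0).resolve_left (div_ne_zero Real.pi_ne_zero hn0.ne'), mul_zero]

theorem isPoincareQuadrature_iff_eq (hab : a < b) {n : ℕ} (hn : 1 ≤ n) {X w : Fin n → ℝ} :
    IsPoincareQuadrature (uniform a b) a b X w ↔
      X = midpointNode a b n ∧ w = fun _ => (n : ℝ)⁻¹ := by
  rw [isPoincareQuadrature_iff hab]
  refine ⟨fun h => h.unique hab (isGaussQuadrature_midpointNode hab hn), ?_⟩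
  rintro ⟨rfl, rfl⟩
  exact isGaussQuadrature_midpointNode hab hn

/-! ### The worst-case error of the midpoint rule -/

/-- The signed distance from `x` to the nearest point of the grid `a + 2 h ℤ`, a sawtooth of period
`2 h` with values in `[-h, h]`. -/
noncomputable def sawtooth (a h x : ℝ) : ℝ :=
  (x - a) - round ((2 * h)⁻¹ * (x - a)) * (2 * h)

theorem sawtooth_eq {a h x : ℝ} (hh : 0 < h) {k : ℤ} (h1 : a + (2 * k - 1) * h ≤ x)
    (h2 : x < a + (2 * k + 1) * h) : sawtooth a h x = x - (a + 2 * k * h) := by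
  have : round ((2 * h)⁻¹ * (x - a)) = k := by
    rw [round_eq_iff, inv_mul_eq_div]
    constructor
    · rw [le_div_iff₀ (by positivity)]; nlinarith
    · rw [div_lt_iff₀ (by positivity)]; nlinarith
  rw [sawtooth, this]
  ring

theorem abs_sawtooth (a h x : ℝ) : |sawtooth a h x| = ‖((x - a : ℝ) : AddCircle (2 * h))‖ := by
  rw [AddCircle.norm_eq, sawtooth]

theorem abs_sawtooth_le {h : ℝ} (hh : 0 < h) (a x : ℝ) : |sawtooth a h x| ≤ h := by
  rw [abs_sawtooth, AddCircle.norm_eq' _ (by positivity)]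
  have := abs_sub_round ((2 * h)⁻¹ * (x - a))
  nlinarith

theorem continuous_cosh_sawtooth (a h : ℝ) : Continuous fun x => Real.cosh (sawtooth a h x) := by
  have : (fun x => Real.cosh (sawtooth a h x)) =
      fun x => Real.cosh ‖((x - a : ℝ) : AddCircle (2 * h))‖ := by
    ext x; rw [← abs_sawtooth, Real.cosh_abs]
  rw [this]
  exact Real.continuous_cosh.comp
    ((AddCircle.continuous_mk' _).comp (continuous_id.sub continuous_const)).norm

theorem measurable_sawtooth (a h : ℝ) : Measurable (sawtooth a h) := by
  unfold sawtooth
  simp only [round_eq]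
  have h1 : Measurable fun x : ℝ => ⌊(2 * h)⁻¹ * (x - a) + 1 / 2⌋ :=
    Measurable.floor (by fun_prop)
  have h2 : Measurable fun x : ℝ => ((⌊(2 * h)⁻¹ * (x - a) + 1 / 2⌋ : ℤ) : ℝ) :=
    (measurable_from_top (f := fun k : ℤ => (k : ℝ))).comp h1
  fun_prop

/-- The sawtooth has slope one, except at its jumps, the odd multiples of `h` from `a`. -/
theorem hasDerivAt_sawtooth {h : ℝ} (hh : 0 < h) {a x : ℝ}
    (hx : x ∉ range fun k : ℤ => a + (2 * k + 1) * h) : HasDerivAt (sawtooth a h) 1 x := by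
  set k := round ((2 * h)⁻¹ * (x - a)) with hk
  obtain ⟨h1, h2⟩ := round_eq_iff.1 hk.symm
  rw [inv_mul_eq_div] at h1 h2
  rw [le_div_iff₀ (by positivity)] at h1
  rw [div_lt_iff₀ (by positivity)] at h2
  have h1' : a + (2 * k - 1) * h ≠ x := fun he => hx ⟨k - 1, by push_cast; linarith⟩
  have h3 : a + (2 * k - 1) * h < x := lt_of_le_of_ne (by nlinarith) h1'
  have h4 : x < a + (2 * k + 1) * h := by nlinarith
  have h5 : HasDerivAt (fun x : ℝ => x - (a + 2 * k * h)) 1 x := (hasDerivAt_id' x).sub_const _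
  refine h5.congr_of_eventuallyEq ?_
  filter_upwards [Ioo_mem_nhds h3 h4] with y hy using sawtooth_eq hh hy.1.le hy.2

/-- The Riesz representer in `H¹` of the error of the midpoint rule with cells of length `2 h`.
On each cell it solves `g - g'' = 1` away from the midpoint, with `g' = 0` at the ends of the cell,
and `g'` jumps by `2 h` at the midpoint. -/
noncomputable def representer (a h x : ℝ) : ℝ :=
  1 - h / Real.sinh h * Real.cosh (sawtooth a h x)

/-- The derivative of `representer` away from the midpoints. -/
noncomputable def representerDeriv (a h x : ℝ) : ℝ :=
  -(h / Real.sinh h * Real.sinh (sawtooth a h x))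

theorem memH1_const_mul_representer (hab : a < b) {h : ℝ} (hh : 0 < h) (t : ℝ) :
    MemH1 (uniform a b) a b (fun x => t * representer a h x)
      (fun x => t * representerDeriv a h x) := by
  have := isProbabilityMeasure_uniform hab
  refine memH1_of_hasDerivAt_off_countable hab
    (countable_range fun k : ℤ => a + (2 * k + 1) * h) ?_ (fun x hx => ?_) ?_
  · exact (continuous_const.mul (continuous_const.sub
      (continuous_const.mul (continuous_cosh_sawtooth a h)))).continuousOn
  · have := ((((hasDerivAt_sawtooth hh hx.2).cosh).const_mul (h / Real.sinh h)).const_sub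
      1).const_mul t
    exact this.congr_deriv (by rw [representerDeriv]; ring)
  · refine MemLp.const_mul (MemLp.of_bound ?_ (|h / Real.sinh h| * Real.sinh h) ?_) t
    · unfold representerDeriv
      exact ((Real.measurable_sinh.comp
        (measurable_sawtooth a h)).const_mul _).neg.aestronglyMeasurable
    · refine Eventually.of_forall fun x => ?_
      rw [representerDeriv, norm_neg, norm_mul, Real.norm_eq_abs, Real.norm_eq_abs, Real.abs_sinh]
      gcongr
      exact Real.sinh_le_sinh.2 (abs_sawtooth_le hh a x)

theorem memH1_representer (hab : a < b) {h : ℝ} (hh : 0 < h) :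
    MemH1 (uniform a b) a b (representer a h) (representerDeriv a h) := by
  simpa using memH1_const_mul_representer hab hh 1

theorem MemH1.intervalIntegrable {μ : Measure ℝ} {f f' : ℝ → ℝ} (hf : MemH1 μ a b f f')
    {p q : ℝ} (hp : p ∈ Icc a b) (hq : q ∈ Icc a b) :
    IntervalIntegrable f volume p q :=
  (hf.continuousOn.mono (uIcc_subset_Icc hp hq)).intervalIntegrable

/-- The inner product in `H¹` of `f` with the representer, over an interval `[p, q]` on which the
nearest grid point is constant. -/
theorem MemH1.integral_mul_representer_halfCell (hab : a < b) {f f' : ℝ → ℝ}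
    (hf : MemH1 (uniform a b) a b f f') {h : ℝ} (hh : 0 < h) (k : ℤ) {p q : ℝ} (hpq : p ≤ q)
    (hp : p ∈ Icc a b) (hq : q ∈ Icc a b) (h1 : a + (2 * k - 1) * h ≤ p)
    (h2 : q ≤ a + (2 * k + 1) * h) :
    ∫ x in p..q, (f x * representer a h x + f' x * representerDeriv a h x) =
      (∫ x in p..q, f x) - h / Real.sinh h *
        (f q * Real.sinh (q - (a + 2 * k * h)) - f p * Real.sinh (p - (a + 2 * k * h))) := by
  set e := a + 2 * k * h with he
  set c := h / Real.sinh h with hc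
  have hv : ContDiff ℝ 1 (fun x => Real.sinh (x - e)) := by fun_prop
  have hvd : deriv (fun x => Real.sinh (x - e)) = fun x => Real.cosh (x - e) := by
    ext x
    simp
  have hparts := hf.integral_mul_deriv_eq hab hv hp hq
  rw [hvd] at hparts
  have i1 : IntervalIntegrable f volume p q := hf.intervalIntegrable hp hq
  have i2 : IntervalIntegrable (fun x => f x * Real.cosh (x - e)) volume p q :=
    i1.mul_continuousOn (by fun_prop)
  have i3 : IntervalIntegrable (fun x => f' x * Real.sinh (x - e)) volume p q := by
    refine IntervalIntegrable.mul_continuousOn ?_ (by fun_prop)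
    exact (intervalIntegrable_of_memLp_uniform hab hf.memLp_deriv).mono_set
      (by rw [uIcc_of_le hab.le]; exact uIcc_subset_Icc hp hq)
  have hcongr : EqOn (fun x => f x * representer a h x + f' x * representerDeriv a h x)
      (fun x => f x - c * (f x * Real.cosh (x - e) + f' x * Real.sinh (x - e))) (Ioo p q) := by
    intro x hx
    simp only [representer, representerDeriv]
    rw [sawtooth_eq hh (h1.trans hx.1.le) (hx.2.trans_le h2), ← he, ← hc]
    ring
  rw [intervalIntegral.integral_congr_Ioo_of_le hpq hcongr,
    intervalIntegral.integral_sub i1 ((i2.add i3).const_mul c), intervalIntegral.integral_const_mul,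
    intervalIntegral.integral_add i2 i3, hparts]
  ring

/-- The inner product in `H¹` with the representer is the error of the midpoint rule. -/
theorem MemH1.integral_mul_representer (hab : a < b) {f f' : ℝ → ℝ}
    (hf : MemH1 (uniform a b) a b f f') {n : ℕ} (hn : 1 ≤ n) :
    ∫ x, (f x * representer a ((b - a) / (2 * n)) x +
        f' x * representerDeriv a ((b - a) / (2 * n)) x) ∂uniform a b =
      (∫ x, f x ∂uniform a b) - ∑ i, (n : ℝ)⁻¹ * f (midpointNode a b n i) := by
  have hba := sub_pos.2 hab
  have hn0 : (0 : ℝ) < n := by exact_mod_cast hn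
  simp only [midpointNode]
  set h := (b - a) / (2 * n) with hhdef
  have hh : 0 < h := by positivity
  have hb : a + 2 * n * h = b := by rw [hhdef]; field_simp; ring
  have hr := memH1_representer hab hh
  have hmem : ∀ s : ℝ, 0 ≤ s → s ≤ 2 * n → a + s * h ∈ Icc a b := fun s h0 h1 =>
    ⟨by nlinarith, by nlinarith⟩
  set D : ℝ → ℝ := fun x => f x * representer a h x + f' x * representerDeriv a h x with hD
  have hDi : IntervalIntegrable D volume a b := by
    have h1 : Integrable D (uniform a b) :=
      (hf.memLp.integrable_mul hr.memLp).add (hf.memLp_deriv.integrable_mul hr.memLp_deriv)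
    have h2 := memLp_one_iff_integrable.2 h1
    rw [memLp_uniform_iff hab] at h2
    rw [intervalIntegrable_iff_integrableOn_Icc_of_le hab.le]
    exact memLp_one_iff_integrable.1 h2
  have hDi' : ∀ {p q : ℝ}, p ∈ Icc a b → q ∈ Icc a b → IntervalIntegrable D volume p q :=
    fun hp hq => hDi.mono_set (by rw [uIcc_of_le hab.le]; exact uIcc_subset_Icc hp hq)
  have hcell : ∀ i < n, ∫ x in a + 2 * i * h..a + 2 * (i + 1 : ℕ) * h, D x =
      (∫ x in a + 2 * i * h..a + 2 * (i + 1 : ℕ) * h, f x) -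
        2 * h * f (a + (2 * i + 1) * h) := by
    intro i hi
    have hi' : (i : ℝ) + 1 ≤ n := by exact_mod_cast hi
    have hi0 : (0 : ℝ) ≤ i := i.cast_nonneg
    have m1 := hmem (2 * i) (by positivity) (by linarith)
    have m2 := hmem (2 * i + 1) (by positivity) (by linarith)
    have m3 := hmem (2 * (i + 1 : ℕ)) (by positivity) (by push_cast; linarith)
    have l := hf.integral_mul_representer_halfCell hab hh (i : ℤ) (by nlinarith) m1 m2
      (by push_cast; nlinarith) (by push_cast; nlinarith)
    have r := hf.integral_mul_representer_halfCell hab hh ((i + 1 : ℕ) : ℤ)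
      (by push_cast; nlinarith) m2 m3 (by push_cast; nlinarith) (by push_cast; nlinarith)
    rw [← intervalIntegral.integral_add_adjacent_intervals (hDi' m1 m2) (hDi' m2 m3),
      ← intervalIntegral.integral_add_adjacent_intervals (hf.intervalIntegrable m1 m2)
        (hf.intervalIntegrable m2 m3), l, r]
    have hs : Real.sinh h ≠ 0 := (Real.sinh_pos_iff.2 hh).ne'
    have s1 : a + (2 * (i : ℝ) + 1) * h - (a + 2 * ((i : ℤ) : ℝ) * h) = h := by push_cast; ring
    have s2 : a + 2 * (i : ℝ) * h - (a + 2 * ((i : ℤ) : ℝ) * h) = 0 := by push_cast; ring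
    have s3 : a + 2 * ((i + 1 : ℕ) : ℝ) * h - (a + 2 * (((i + 1 : ℕ) : ℤ) : ℝ) * h) = 0 := by
      push_cast; ring
    have s4 : a + (2 * (i : ℝ) + 1) * h - (a + 2 * (((i + 1 : ℕ) : ℤ) : ℝ) * h) = -h := by
      push_cast; ring
    rw [s1, s2, s3, s4, Real.sinh_zero, Real.sinh_neg]
    field_simp
    ring
  have hmem' : ∀ i ≤ n, a + 2 * (i : ℝ) * h ∈ Icc a b := fun i hi =>
    hmem (2 * i) (by positivity) (by have : (i : ℝ) ≤ n := by exact_mod_cast hi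
                                     linarith)
  have e1 := intervalIntegral.sum_integral_adjacent_intervals (f := D) (μ := volume)
    (a := fun i : ℕ => a + 2 * (i : ℝ) * h) (n := n)
    fun k hk => hDi' (hmem' k hk.le) (hmem' (k + 1) hk)
  have e2 := intervalIntegral.sum_integral_adjacent_intervals (f := f) (μ := volume)
    (a := fun i : ℕ => a + 2 * (i : ℝ) * h) (n := n)
    fun k hk => hf.intervalIntegrable (hmem' k hk.le) (hmem' (k + 1) hk)
  simp only [Nat.cast_zero, mul_zero, zero_mul, add_zero, hb] at e1 e2
  rw [Finset.sum_congr rfl fun i hi => hcell i (Finset.mem_range.1 hi), Finset.sum_sub_distrib,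
    e2, ← Finset.mul_sum] at e1
  rw [integral_uniform hab, integral_uniform hab, ← e1, ← Finset.mul_sum,
    Fin.sum_univ_eq_sum_range (fun i => f (a + (2 * (i : ℝ) + 1) * h))]
  have : (b - a)⁻¹ * (2 * h) = (n : ℝ)⁻¹ := by rw [hhdef]; field_simp
  rw [mul_sub, ← mul_assoc, this]

theorem representer_midpointNode (hab : a < b) {n : ℕ} (hn : 1 ≤ n) (i : Fin n) :
    representer a ((b - a) / (2 * n)) (midpointNode a b n i) =
      1 - ((b - a) / (2 * n)) / Real.tanh ((b - a) / (2 * n)) := by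
  have hba := sub_pos.2 hab
  have hn0 : (0 : ℝ) < n := by exact_mod_cast hn
  rw [midpointNode]
  set h := (b - a) / (2 * n) with hhdef
  have hh : 0 < h := by positivity
  -- By the rounding convention, the grid point nearest to a midpoint is the one on its right.
  rw [representer, sawtooth_eq hh (k := (i : ℤ) + 1) (by push_cast; nlinarith)
    (by push_cast; nlinarith)]
  have e : a + (2 * ((i : ℕ) : ℝ) + 1) * h - (a + 2 * (((i : ℤ) + 1 : ℤ) : ℝ) * h) = -h := by
    push_cast; ring
  rw [e, Real.cosh_neg, Real.tanh_eq_sinh_div_cosh]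
  have := (Real.sinh_pos_iff.2 hh).ne'
  have := (Real.cosh_pos h).ne'
  field_simp

/-- The squared norm of the representer. Its mean vanishes, since the midpoint rule is exact for
constants, so only its values at the nodes contribute to the error of the rule on it. -/
theorem integral_sq_representer (hab : a < b) {n : ℕ} (hn : 1 ≤ n) :
    (∫ x, representer a ((b - a) / (2 * n)) x ^ 2 ∂uniform a b) +
      ∫ x, representerDeriv a ((b - a) / (2 * n)) x ^ 2 ∂uniform a b =
        ((b - a) / (2 * n)) / Real.tanh ((b - a) / (2 * n)) - 1 := by
  have := isProbabilityMeasure_uniform hab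
  have hba := sub_pos.2 hab
  have hn0 : (0 : ℝ) < n := by exact_mod_cast hn
  have hr := memH1_representer hab (h := (b - a) / (2 * n)) (by positivity)
  have h1 := (memH1_of_contDiff hab (contDiff_const (c := (1 : ℝ)))).integral_mul_representer hab hn
  have h2 := hr.integral_mul_representer hab hn
  simp only [one_mul, deriv_const', zero_mul, add_zero, mul_one, integral_const, probReal_univ,
    smul_eq_mul, Finset.sum_const, Finset.card_univ, Fintype.card_fin, nsmul_eq_mul,
    mul_inv_cancel₀ hn0.ne', sub_self] at h1
  simp only [representer_midpointNode hab hn, h1, Finset.sum_const, Finset.card_univ,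
    Fintype.card_fin, nsmul_eq_mul, mul_inv_cancel_left₀ hn0.ne'] at h2
  rw [← integral_add hr.memLp.integrable_sq hr.memLp_deriv.integrable_sq]
  simp only [pow_two]
  rw [h2]
  ring

/-- By the Cauchy–Schwarz inequality, the worst-case error is the norm of the representer. -/
theorem wce_midpointNode (hab : a < b) {n : ℕ} (hn : 1 ≤ n) :
    wce (uniform a b) a b (midpointNode a b n) (fun _ => (n : ℝ)⁻¹) =
      ENNReal.ofReal √((b - a) / (2 * n) / Real.tanh ((b - a) / (2 * n)) - 1) := by
  have hba := sub_pos.2 hab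
  have hn0 : (0 : ℝ) < n := by exact_mod_cast hn
  have hK := integral_sq_representer hab hn
  have herr := fun {f f' : ℝ → ℝ} (hf : MemH1 (uniform a b) a b f f') =>
    hf.integral_mul_representer hab hn
  have hrt := fun t => memH1_const_mul_representer hab (h := (b - a) / (2 * n)) (by positivity) t
  have hr := memH1_representer hab (h := (b - a) / (2 * n)) (by positivity)
  set r := representer a ((b - a) / (2 * n))
  set r' := representerDeriv a ((b - a) / (2 * n))
  set K := (b - a) / (2 * n) / Real.tanh ((b - a) / (2 * n)) - 1
  have hK0 : 0 ≤ K := by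
    rw [← hK]
    exact add_nonneg (integral_nonneg fun _ => sq_nonneg _) (integral_nonneg fun _ => sq_nonneg _)
  refine le_antisymm ?_ ?_
  · unfold wce
    refine iSup_le fun f => iSup_le fun f' => iSup_le fun hf => iSup_le fun hnorm => ?_
    refine ENNReal.ofReal_le_ofReal (Real.abs_le_sqrt ?_)
    rw [← herr hf]
    have hA : (∫ x, f x ^ 2 ∂uniform a b) + ∫ x, f' x ^ 2 ∂uniform a b ≤ 1 := by
      rw [h1Norm] at hnorm
      simpa using (Real.sqrt_le_iff.1 hnorm).2
    set E := ∫ x, (f x * r x + f' x * r' x) ∂uniform a b with hE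
    have i1 := hf.memLp.integrable_sq
    have i2 := hf.memLp_deriv.integrable_sq
    have i3 := hr.memLp.integrable_sq
    have i4 := hr.memLp_deriv.integrable_sq
    have i5 : Integrable (fun x => f x * r x + f' x * r' x) (uniform a b) :=
      (hf.memLp.integrable_mul hr.memLp).add (hf.memLp_deriv.integrable_mul hr.memLp_deriv)
    -- The squared norm of `f - t r` is a nonnegative quadratic polynomial in `t`.
    have hquad : ∀ t : ℝ, 0 ≤ K * (t * t) + (-2 * E) * t +
        ((∫ x, f x ^ 2 ∂uniform a b) + ∫ x, f' x ^ 2 ∂uniform a b) := by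
      intro t
      have h0 : 0 ≤ ∫ x, ((f x - t * r x) ^ 2 + (f' x - t * r' x) ^ 2) ∂uniform a b :=
        integral_nonneg fun _ => by positivity
      have e : (fun x => (f x - t * r x) ^ 2 + (f' x - t * r' x) ^ 2) = fun x =>
          (f x ^ 2 + f' x ^ 2) + (t * t * (r x ^ 2 + r' x ^ 2) +
            (-2 * t) * (f x * r x + f' x * r' x)) := by ext x; ring
      have j1 : Integrable (fun x => f x ^ 2 + f' x ^ 2) (uniform a b) := i1.add i2
      have j2 : Integrable (fun x => t * t * (r x ^ 2 + r' x ^ 2)) (uniform a b) :=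
        (i3.add i4).const_mul _
      have j3 := i5.const_mul (-2 * t)
      have j4 : Integrable (fun x => t * t * (r x ^ 2 + r' x ^ 2) +
          -2 * t * (f x * r x + f' x * r' x)) (uniform a b) := j2.add j3
      rw [e, integral_add j1 j4, integral_add i1 i2, integral_add j2 j3,
        integral_const_mul, integral_const_mul, integral_add i3 i4, hK, ← hE] at h0
      linarith
    have hdisc := discrim_le_zero hquad
    rw [discrim] at hdisc
    nlinarith
  · rcases hK0.eq_or_lt with hK0 | hK0
    · rw [← hK0]; simp
    -- The supremum is attained at the normalized representer.
    have hs : √K ≠ 0 := (Real.sqrt_pos.2 hK0).ne'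
    have hss : √K * √K = K := Real.mul_self_sqrt hK0.le
    have hmem := hrt (√K)⁻¹
    have hnorm : h1Norm (uniform a b) (fun x => (√K)⁻¹ * r x) (fun x => (√K)⁻¹ * r' x) ≤ 1 := by
      rw [h1Norm]
      simp only [mul_pow]
      rw [integral_const_mul, integral_const_mul, ← mul_add, hK, inv_pow, Real.sq_sqrt hK0.le,
        inv_mul_cancel₀ hK0.ne', Real.sqrt_one]
    refine le_trans ?_ (le_iSup_of_le _ (le_iSup_of_le _ (le_iSup_of_le hmem
      (le_iSup_of_le hnorm le_rfl))))
    refine ENNReal.ofReal_le_ofReal (le_trans (le_of_eq ?_) (le_abs_self _))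
    rw [← herr hmem]
    have e : (fun x => (√K)⁻¹ * r x * r x + (√K)⁻¹ * r' x * r' x) =
        fun x => (√K)⁻¹ * (r x ^ 2 + r' x ^ 2) := by ext x; ring
    rw [e, integral_const_mul,
      integral_add hr.memLp.integrable_sq hr.memLp_deriv.integrable_sq, hK,
      eq_inv_mul_iff_mul_eq₀ hs, hss]

/-! ### Asymptotics -/

/-- The leading term of the expansion `h / tanh h - 1 = h² / 3 + O(h⁴)`. -/
theorem tendsto_div_tanh_sub_one_div_sq :
    Tendsto (fun h : ℝ => (h / Real.tanh h - 1) / h ^ 2) (𝓝[>] 0) (𝓝 (1 / 3)) := by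
  have hsinh : Tendsto (fun h : ℝ => Real.sinh h / h) (𝓝[>] 0) (𝓝 1) := by
    have := (Real.hasDerivAt_sinh 0).tendsto_slope.mono_left
      (nhdsWithin_mono (0 : ℝ) (fun x (hx : 0 < x) => hx.ne'))
    rw [Real.cosh_zero] at this
    refine this.congr fun h => ?_
    rw [slope_def_field, Real.sinh_zero, sub_zero, sub_zero]
  have hpos : ∀ᶠ h : ℝ in 𝓝[>] 0, 0 < h := eventually_mem_nhdsWithin
  have hnum : Tendsto (fun h : ℝ => (h * Real.cosh h - Real.sinh h) / h ^ 3) (𝓝[>] 0)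
      (𝓝 (1 / 3)) := by
    refine HasDerivAt.lhopital_zero_nhdsGT (f' := fun h => h * Real.sinh h)
      (g' := fun h => 3 * h ^ 2) ?_ ?_ ?_ ?_ ?_ ?_
    · refine Eventually.of_forall fun h => ?_
      exact (((hasDerivAt_id' h).mul (Real.hasDerivAt_cosh h)).sub
        (Real.hasDerivAt_sinh h)).congr_deriv (by ring)
    · exact Eventually.of_forall fun h => by simpa using hasDerivAt_pow 3 h
    · filter_upwards [hpos] with h hh using by positivity
    · have : Continuous fun h : ℝ => h * Real.cosh h - Real.sinh h := by fun_prop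
      simpa using (this.tendsto 0).mono_left nhdsWithin_le_nhds
    · have : Continuous fun h : ℝ => h ^ 3 := by fun_prop
      simpa using (this.tendsto 0).mono_left nhdsWithin_le_nhds
    · refine (hsinh.div_const 3).congr' ?_
      filter_upwards [hpos] with h hh
      field_simp
  have := hnum.div hsinh one_ne_zero
  rw [div_one] at this
  refine this.congr' ?_
  filter_upwards [hpos] with h hh
  have h1 := (Real.sinh_pos_iff.2 hh).ne'
  have h2 := (Real.cosh_pos h).ne'
  simp only [Pi.div_apply]
  rw [Real.tanh_eq_sinh_div_cosh]
  field_simp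

theorem isEquivalent_sqrt_div_tanh_sub_one {L : ℝ} (hL : 0 < L) :
    Asymptotics.IsEquivalent atTop
      (fun n : ℕ => √(L / (2 * (n : ℝ)) / Real.tanh (L / (2 * (n : ℝ))) - 1))
      (fun n : ℕ => L / (2 * √3) * (1 / (n : ℝ))) := by
  have hpos : ∀ᶠ n : ℕ in atTop, (0 : ℝ) < n := by
    filter_upwards [eventually_gt_atTop 0] with n hn using by exact_mod_cast hn
  refine (Asymptotics.isEquivalent_iff_tendsto_one ?_).2 ?_
  · filter_upwards [hpos] with n hn using by positivity
  have hlim : Tendsto (fun n : ℕ => L / (2 * (n : ℝ))) atTop (𝓝[>] 0) := by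
    refine tendsto_nhdsWithin_iff.2 ⟨?_, ?_⟩
    · exact Tendsto.const_div_atTop
        (tendsto_natCast_atTop_atTop.const_mul_atTop (by norm_num)) _
    · filter_upwards [hpos] with n hn using div_pos hL (by positivity)
  have h1 := (tendsto_div_tanh_sub_one_div_sq.comp hlim).sqrt.const_mul √3
  have h2 : √3 * √(1 / 3 : ℝ) = 1 := by
    rw [← Real.sqrt_mul (by norm_num)]; norm_num
  rw [h2] at h1
  refine h1.congr' ?_
  filter_upwards [hpos] with n hn
  simp only [Function.comp, Pi.div_apply]
  rw [Real.sqrt_div' _ (sq_nonneg _), Real.sqrt_sq (by positivity)]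
  have : √3 ≠ 0 := by positivity
  field_simp

end PoincareQuadrature

theorem mainTheorem7 (a b : ℝ) (hab : a < b) :
    (∀ n : ℕ, 1 ≤ n → ∃! Q : (Fin n → ℝ) × (Fin n → ℝ),
      PoincareQuadrature.IsPoincareQuadrature
        (PoincareQuadrature.uniform a b) a b Q.1 Q.2) ∧
    ∀ X w : (n : ℕ) → Fin n → ℝ,
      (∀ n : ℕ, 1 ≤ n → PoincareQuadrature.IsPoincareQuadrature
        (PoincareQuadrature.uniform a b) a b (X n) (w n)) →
      (∀ n : ℕ, 1 ≤ n →
        PoincareQuadrature.wce (PoincareQuadrature.uniform a b) a b (X n) (w n) =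
          ENNReal.ofReal (Real.sqrt
            (((b - a) / (2 * (n : ℝ))) / Real.tanh ((b - a) / (2 * (n : ℝ))) - 1))) ∧
      Asymptotics.IsEquivalent Filter.atTop
        (fun n : ℕ =>
          (PoincareQuadrature.wce (PoincareQuadrature.uniform a b) a b (X n) (w n)).toReal)
        (fun n : ℕ => (b - a) / (2 * Real.sqrt 3) * (1 / (n : ℝ))) := by
  refine ⟨fun n hn => ?_, fun X w hXw => ?_⟩
  · refine ⟨(PoincareQuadrature.midpointNode a b n, fun _ => (n : ℝ)⁻¹), ?_, ?_⟩
    · exact (PoincareQuadrature.isPoincareQuadrature_iff_eq hab hn).2 ⟨rfl, rfl⟩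
    · intro Q hQ
      obtain ⟨h1, h2⟩ := (PoincareQuadrature.isPoincareQuadrature_iff_eq hab hn).1 hQ
      exact Prod.ext h1 h2
  · have hwce : ∀ n : ℕ, 1 ≤ n →
        PoincareQuadrature.wce (PoincareQuadrature.uniform a b) a b (X n) (w n) =
          ENNReal.ofReal (Real.sqrt
            (((b - a) / (2 * (n : ℝ))) / Real.tanh ((b - a) / (2 * (n : ℝ))) - 1)) := by
      intro n hn
      obtain ⟨h1, h2⟩ := (PoincareQuadrature.isPoincareQuadrature_iff_eq hab hn).1 (hXw n hn)
      rw [h1, h2]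
      exact PoincareQuadrature.wce_midpointNode hab hn
    refine ⟨hwce, ?_⟩
    refine (PoincareQuadrature.isEquivalent_sqrt_div_tanh_sub_one (sub_pos.2 hab)).congr_left ?_
    filter_upwards [Filter.eventually_ge_atTop 1] with n hn
    rw [hwce n hn, ENNReal.toReal_ofReal (Real.sqrt_nonneg _)]
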